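/- Let $p=(p_x)_{x\in\mathbb N}$, $\mathbb N=\{0,1,2,\dots\}$, be a probability mass function and let $X_1,X_2,\dots$ be i.i.d. $\mathbb N$-valued random variables with mass function $p$. For $n\ge 1$ let $\widehat p_{n,x}=n^{-1}\#\{i\le n: X_i=x\}$ be the empirical estimator, and put $M=\max\{X_1,\dots,X_n\}$. Let the rearrangement estimator $\widehat p_n^R$ be the vector $(\widehat p_{n,0},\dots,\widehat p_{n,M})$ sorted into decreasing order, and let the Grenander estimator (the MLE under monotonicity) $\widehat p_n^G$ be given by $\widehat p^G_{n,x}=L(x)-L(x-1)$, $0\le x\le M$, where $L$ is the least concave majorant on $[-1,M]$ of the points $(j,\sum_{i=0}^{j}\widehat p_{n,i})$, $j=-1,0,\dots,M$ (the empty sum is $0$); both are extended by $0$ to $x>M$. For $q,\tilde q:\mathbb N\to[0,\infty)$ let $H(q,\tilde q)=\big(\tfrac12\sum_{x\ge0}(\sqrt{q_x}-\sqrt{\tilde q_x})^2\big)^{1/2}$, $\|q-\tilde q\|_k=\big(\sum_{x\ge0}|q_x-\tilde q_x|^k\big)^{1/k}$ for real $k$ with $1\le k<\infty$, and $\|q-\tilde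 q\|_\infty=\sup_{x\ge0}|q_x-\tilde q_x|$. (i) If $p$ is monotone decreasing, i.e. $p_x\ge p_{x+1}$ for all $x$, then for every $n\ge1$ and every outcome of the sample $$\max\{H(\widehat p_n^G,p),H(\widehat p_n^R,p)\}\le H(\widehat p_n,p),\qquad \max\{\|\widehat p_n^G-p\|_k,\|\widehat p_n^R-p\|_k\}\le\|\widehat p_n-p\|_k,\quad 1\le k\le\infty.$$ (ii) If $p$ is the uniform distribution on $\{0,\dots,y\}$ for some $y\in\mathbb N$, then almost surely, for all $n\ge1$, $$H(\widehat p_n,p)=H(\widehat p_n^R,p),\qquad \|\widehat p_n^R-p\|_k=\|\widehat p_n-p\|_k,\quad 1\le k\le\infty.$$ (iii) For every $n\ge1$ and every outcome of the sample, if $\widehat p_n$ is monotone decreasing on $\mathbb N$ then $\widehat p_n^G=\widehat p_n^R=\widehat p_n$. If $p$ is the uniform distribution on $\{0,\dots,y\}$, $y\in\mathbb N$, then for every $n\ge 1$ the event that $\widehat p_n$ is monotone decreasing has probability $P(\widehat p_{n,0}\ge\widehat p_{n,1}\ge\cdots\ge\widehat p_{n,y})$, and $$P(\widehat p_{n,0}\ge\widehat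 p_{n,1}\ge\cdots\ge\widehat p_{n,y})\to\frac1{(y+1)!}\qquad(n\to\infty).$$ If instead the support of $p$ is $\{0,\dots,y\}$, $y\in\mathbb N$, and $p_0>p_1>\cdots>p_y$, then again, for every $n\ge1$, $\widehat p_n$ is monotone decreasing with probability $P(\widehat p_{n,0}\ge\widehat p_{n,1}\ge\cdots\ge\widehat p_{n,y})$, and this probability tends to $1$ as $n\to\infty$. -/

import Mathlib

open MeasureTheory ProbabilityTheory Filter Topology
open scoped ENNReal

noncomputable section

namespace MonotonePMF

/-- `p` is a probability mass function on `ℕ = {0, 1, 2, …}`. -/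
def IsMassFunction (p : ℕ → ℝ) : Prop :=
  (∀ x, 0 ≤ p x) ∧ HasSum p 1

/-- The uniform mass function on `{0, …, y}`. -/
def uniformMass (y : ℕ) (x : ℕ) : ℝ :=
  if x ≤ y then 1 / ((y : ℝ) + 1) else 0

/-- `X 0, X 1, …` are i.i.d. `ℕ`-valued random variables with mass function `p`. -/
structure IsIIDSample {Ω : Type*} [MeasurableSpace Ω] (P : Measure Ω)
    (X : ℕ → Ω → ℕ) (p : ℕ → ℝ) : Prop where
  measurable : ∀ i, Measurable (X i)
  indep : iIndepFun X P
  law : ∀ i x, P.real {ω | X i ω = x} = p x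

/-- The first `n` observations at the outcome `ω`. -/
def sample {Ω : Type*} (X : ℕ → Ω → ℕ) (n : ℕ) (ω : Ω) : Fin n → ℕ :=
  fun i => X i ω

/-! ### The operators `rear` and `gren` on vectors `(w_0, …, w_k)` -/

/-- The vector `w` sorted into decreasing order. -/
def rear {k : ℕ} (w : Fin (k + 1) → ℝ) : Fin (k + 1) → ℝ :=
  w ∘ Tuple.sort (OrderDual.toDual ∘ w)

/-- The least concave majorant, on the domain `D`, of a set `S` of points of the plane: the
pointwise infimum of all concave functions on `D` whose graph lies above all points of `S`. -/
def leastConcaveMajorant (D : Set ℝ) (S : Set (ℝ × ℝ)) (t : ℝ) : ℝ :=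
  sInf {v | ∃ g : ℝ → ℝ, ConcaveOn ℝ D g ∧ (∀ q ∈ S, q.2 ≤ g q.1) ∧ v = g t}

/-- The points `(j, ∑_{i ≤ j} w_i)`, `j = -1, 0, …, k`; here `m = j + 1` runs over `0, …, k + 1`. -/
def cumulativePoints {k : ℕ} (w : Fin (k + 1) → ℝ) : Set (ℝ × ℝ) :=
  {q | ∃ m : ℕ, m ≤ k + 1 ∧
    q = ((m : ℝ) - 1, ∑ i : Fin (k + 1), if (i : ℕ) < m then w i else 0)}

/-- The `k + 1` successive slopes of the least concave majorant of `cumulativePoints w`. -/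
def gren {k : ℕ} (w : Fin (k + 1) → ℝ) : Fin (k + 1) → ℝ := fun x =>
  leastConcaveMajorant (Set.Icc (-1) (k : ℝ)) (cumulativePoints w) ((x : ℕ) : ℝ) -
    leastConcaveMajorant (Set.Icc (-1) (k : ℝ)) (cumulativePoints w) (((x : ℕ) : ℝ) - 1)

/-- A vector `(w_0, …, w_k)` viewed as a sequence on `ℕ` that vanishes beyond `k`. -/
def extendZero {k : ℕ} (w : Fin (k + 1) → ℝ) (x : ℕ) : ℝ :=
  if h : x < k + 1 then w ⟨x, h⟩ else 0

/-! ### The three estimators, for an observed sample `s` of size `n` -/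

/-- The empirical estimator `x ↦ n⁻¹ #{i : s i = x}`. -/
def empirical {n : ℕ} (s : Fin n → ℕ) (x : ℕ) : ℝ :=
  (n : ℝ)⁻¹ * ∑ i : Fin n, if s i = x then 1 else 0

/-- The largest observation. -/
def sampleMax {n : ℕ} (s : Fin n → ℕ) : ℕ :=
  Finset.univ.sup s

/-- The empirical estimator as a vector indexed by `{0, …, max s}`, which contains its support. -/
def empiricalVec {n : ℕ} (s : Fin n → ℕ) : Fin (sampleMax s + 1) → ℝ :=
  fun x => empirical s x

/-- The rearrangement estimator. -/
def rearrangement {n : ℕ} (s : Fin n → ℕ) : ℕ → ℝ :=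
  extendZero (rear (empiricalVec s))

/-- The Grenander estimator (the MLE under monotonicity). -/
def grenander {n : ℕ} (s : Fin n → ℕ) : ℕ → ℝ :=
  extendZero (gren (empiricalVec s))

/-! ### Distances -/

/-- The Hellinger distance: `H²(p, q) = 2⁻¹ ∑_x (√p_x - √q_x)²`. -/
def hellinger (p q : ℕ → ℝ) : ℝ≥0∞ :=
  (2⁻¹ * ∑' x, ENNReal.ofReal ((√(p x) - √(q x)) ^ 2)) ^ (1 / 2 : ℝ)

/-- The `ℓ_k` distance, `1 ≤ k ≤ ∞`. -/
def ellDist (k : ℝ≥0∞) (p q : ℕ → ℝ) : ℝ≥0∞ :=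
  if k = ∞ then ⨆ x, ENNReal.ofReal |p x - q x|
  else (∑' x, ENNReal.ofReal |p x - q x| ^ k.toReal) ^ (1 / k.toReal)

/-- `q_0 ≥ q_1 ≥ ⋯ ≥ q_y`. -/
def DecreasingUpTo (y : ℕ) (q : ℕ → ℝ) : Prop :=
  ∀ x, x < y → q (x + 1) ≤ q x

end MonotonePMF

end

noncomputable section

namespace MonotonePMF

/-! ### Convex functions -/

/-! For (i), let `w` be the empirical vector and `v` the restriction of `p`, both on `{0, …, M}`.
Past `M` all three estimators vanish, so only finite sums have to be compared. For finite `k` the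
`ℓ_k` distance is governed by a sum of a convex function of the differences, and the sup distance by
the convex costs `max (|x| - t) 0`; hence `ConvexCloser` suffices.

Sorting: for convex `f` the cost `f (a - b)` has the Monge property, so the rearrangement inequality
applies. The Hellinger case is the square cost applied to square roots.

Grenander: write `g = gren w`. The tangent inequality at `g i - v i` reduces the claim to `0 ≤ ∑ s i
* (w i - g i)` with `s i` a subgradient there. Summation by parts rewrites this in terms of the gaps
between partial sums and majorant, which vanish at both ends. Where a gap is nonzero the majorant is
linear, so `g` is constant and, `v` being decreasing, `s` increases: every term has the right sign
(`sum_mul_sub_gren_nonneg`). The weights `-√v / √g` give the Hellinger bound.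

For (ii), sorting permutes the values, and almost surely `p` is constant on `{0, …, M}`.

For (iii), the partial sums of a decreasing vector are already concave. In the strictly decreasing
case the law of large numbers concludes. In the uniform case exchangeability makes the `(y + 1)!`
strict orderings equally likely; together they form the event without ties. A tie forces a centred
i.i.d. sum to vanish, which has probability tending to `0` by the central limit theorem, as the
limiting Gaussian has no atom. -/

theorem _root_.ConvexOn.add_le_add_of_add_eq {f : ℝ → ℝ} (hf : ConvexOn ℝ Set.univ f)
    {a b c d : ℝ} (hca : c ≤ a) (had : a ≤ d) (hsum : a + b = c + d) : f a + f b ≤ f c + f d := by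
  obtain rfl | hcd := eq_or_lt_of_le (hca.trans had)
  · have h1 : a = c := le_antisymm had hca
    have h2 : b = c := by linarith
    rw [h1, h2]
  · have hpos : 0 < d - c := sub_pos.2 hcd
    set t := (d - a) / (d - c) with ht
    have ht0 : 0 ≤ t := div_nonneg (by linarith) hpos.le
    have ht1 : 0 ≤ 1 - t := by
      rw [sub_nonneg, ht, div_le_one hpos]; linarith
    have htm : t * (d - c) = d - a := div_mul_cancel₀ _ hpos.ne'
    have h1 := hf.2 (Set.mem_univ c) (Set.mem_univ d) ht0 ht1 (by ring)
    have h2 := hf.2 (Set.mem_univ c) (Set.mem_univ d) ht1 ht0 (by ring)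
    have ea : t • c + (1 - t) • d = a := by simp only [smul_eq_mul]; linarith
    have eb : (1 - t) • c + t • d = b := by simp only [smul_eq_mul]; linarith
    rw [ea] at h1
    rw [eb] at h2
    simp only [smul_eq_mul] at h1 h2
    linarith

/-- The right derivative is such a choice. Monotonicity transfers the order of the differences `gren
w i - v i` to the weights in `sum_mul_sub_gren_nonneg`. -/
theorem _root_.ConvexOn.exists_monotone_subgradient {f : ℝ → ℝ} (hf : ConvexOn ℝ Set.univ f) :
    ∃ s : ℝ → ℝ, Monotone s ∧ ∀ x y, f x + s x * (y - x) ≤ f y := by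
  refine ⟨fun x => derivWithin f (Set.Ioi x) x, fun x y hxy => ?_, fun x y => ?_⟩
  · exact hf.monotoneOn_rightDeriv (by simp) (by simp) hxy
  · rcases lt_trichotomy x y with h | rfl | h
    · have := hf.rightDeriv_le_slope_of_mem_interior (by simp : x ∈ interior Set.univ)
        (Set.mem_univ y) h
      rw [slope_def_field, le_div_iff₀ (sub_pos.2 h)] at this
      linarith
    · simp
    · have h1 := hf.slope_le_leftDeriv_of_mem_interior (Set.mem_univ y)
        (by simp : x ∈ interior Set.univ) h
      have h2 := hf.leftDeriv_le_rightDeriv_of_mem_interior (by simp : x ∈ interior Set.univ)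
      have := h1.trans h2
      rw [slope_def_field, div_le_iff₀ (sub_pos.2 h)] at this
      linarith

/-- `u` is at least as close to `v` as `w` is, for every convex cost of the differences. -/
def ConvexCloser {m : ℕ} (u w v : Fin m → ℝ) : Prop :=
  ∀ f : ℝ → ℝ, ConvexOn ℝ Set.univ f → ∑ i, f (u i - v i) ≤ ∑ i, f (w i - v i)

/-! ### Rearrangement -/

/-- The rearrangement inequality for a cost with the Monge property. -/
theorem sum_monge_le_sum_comp_perm {ι : Type*} [DecidableEq ι] {c : ℝ → ℝ → ℝ}
    (hc : ∀ a a' b b', a ≤ a' → b ≤ b' → c a b + c a' b' ≤ c a b' + c a' b)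
    {f g : ι → ℝ} {s : Finset ι} {σ : Equiv.Perm ι} (hfg : MonovaryOn f g s)
    (hσ : {x | σ x ≠ x} ⊆ s) :
    ∑ i ∈ s, c (f i) (g i) ≤ ∑ i ∈ s, c (f i) (g (σ i)) := by
  induction s using Finset.induction_on_max_value (fun i ↦ toLex (g i, f i)) generalizing σ with
  | empty => simp
  | insert a s has hamax hind =>
  -- `τ` fixes `a`, sends `σ.symm a` to `σ a` and otherwise agrees with `σ`. The induction
  -- hypothesis covers `τ`; returning to `σ` costs one Monge exchange, with `a` maximal in both `f`
  -- and `g`.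
  set τ : Equiv.Perm ι := σ.trans (Equiv.swap a (σ a)) with hτ
  have hτs : {x | τ x ≠ x} ⊆ s := by
    intro x hx
    simp only [τ, Ne, Set.mem_ofPred_eq, Equiv.swap_comp_apply] at hx
    split_ifs at hx with h₁ h₂
    · obtain rfl | hax := eq_or_ne x a
      · contradiction
      · exact Finset.mem_of_mem_insert_of_ne (hσ fun h ↦ hax <| h.symm.trans h₁) hax
    · exact (hx <| σ.injective h₂.symm).elim
    · exact Finset.mem_of_mem_insert_of_ne (hσ hx) (ne_of_apply_ne _ h₂)
  have hind := hind (hfg.subset <| by simp) hτs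
  simp_rw [Finset.sum_insert has]
  refine (add_le_add_right hind _).trans ?_
  obtain hσa | hσa := eq_or_ne a (σ a)
  · rw [hτ, ← hσa, Equiv.swap_self, Equiv.trans_refl]
  have h1s : σ.symm a ∈ s := by
    rw [Ne, ← Equiv.Perm.inv_eq_iff_eq] at hσa
    refine Finset.mem_of_mem_insert_of_ne (hσ fun h ↦ hσa ?_) hσa
    rwa [Equiv.apply_symm_apply, eq_comm] at h
  simp only [← s.sum_erase_add _ h1s, add_comm]
  rw [← add_assoc, ← add_assoc]
  simp only [hτ, Equiv.swap_apply_left, Function.comp_apply, Equiv.coe_trans,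
    Equiv.apply_symm_apply]
  have hf1 : f (σ.symm a) ≤ f a := by
    specialize hamax (σ.symm a) h1s
    rw [Prod.Lex.toLex_le_toLex] at hamax
    rcases hamax with hamax | hamax
    · exact hfg (Finset.mem_insert_of_mem h1s) (Finset.mem_insert_self _ _) hamax
    · exact hamax.2
  have hg1 : g (σ a) ≤ g a := by
    specialize hamax (σ a)
      (Finset.mem_of_mem_insert_of_ne (hσ <| σ.injective.ne hσa.symm) hσa.symm)
    rw [Prod.Lex.toLex_le_toLex] at hamax
    rcases hamax with hamax | hamax
    · exact hamax.le
    · exact hamax.1.le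
  refine add_le_add ?_ (Finset.sum_congr rfl fun x hx ↦ ?_).le
  · have := hc _ _ _ _ hf1 hg1
    linarith
  · rw [Finset.mem_erase, Ne, Equiv.eq_symm_apply] at hx
    rw [Equiv.swap_apply_of_ne_of_ne hx.1 (σ.injective.ne _)]
    rintro rfl
    exact has hx.2

theorem convexCloser_comp_perm {m : ℕ} {w v : Fin m → ℝ} {σ : Equiv.Perm (Fin m)}
    (hw : Antitone (w ∘ σ)) (hv : Antitone v) : ConvexCloser (w ∘ σ) w v := by
  intro f hf
  have hmv : Monovary (w ∘ σ) v := hw.monovary hv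
  have key := sum_monge_le_sum_comp_perm (c := fun a b => f (a - b)) (s := Finset.univ) (σ := σ)
    (fun a a' b b' ha hb => ?_) (hmv.monovaryOn _) (by simp)
  · refine key.trans_eq ?_
    exact Equiv.sum_comp σ fun i => f (w i - v i)
  -- `a - b'` and `a' - b` enclose `a - b` and `a' - b'`, and the two pairs have the same sum.
  · have := hf.add_le_add_of_add_eq (a := a - b) (b := a' - b') (c := a - b') (d := a' - b)
      (by linarith) (by linarith) (by ring)
    exact this

theorem antitone_rear {k : ℕ} (w : Fin (k + 1) → ℝ) : Antitone (rear w) :=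
  fun _ _ h => Tuple.monotone_sort (OrderDual.toDual ∘ w) h

theorem convexCloser_rear {k : ℕ} (w : Fin (k + 1) → ℝ) {v : Fin (k + 1) → ℝ} (hv : Antitone v) :
    ConvexCloser (rear w) w v :=
  convexCloser_comp_perm (antitone_rear w) hv

theorem sum_sq_sqrt_rear_le {k : ℕ} (w : Fin (k + 1) → ℝ) {v : Fin (k + 1) → ℝ}
    (hv : Antitone v) :
    ∑ i, (√(rear w i) - √(v i)) ^ 2 ≤ ∑ i, (√(w i) - √(v i)) ^ 2 :=
  convexCloser_comp_perm (w := fun i => √(w i)) (v := fun i => √(v i))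
    (fun _ _ h => Real.sqrt_le_sqrt (antitone_rear w h)) (fun _ _ h => Real.sqrt_le_sqrt (hv h))
    (fun x => x ^ 2) (even_two.convexOn_pow)

theorem rear_eq_self {k : ℕ} {w : Fin (k + 1) → ℝ} (hw : Antitone w) : rear w = w := by
  have h : Monotone (OrderDual.toDual ∘ w) := fun _ _ h => hw h
  rw [rear, Tuple.sort_eq_refl_iff_monotone.2 h]
  rfl

/-! ### The least concave majorant -/

/-- The partial sums of `w`. -/
def cumulative {k : ℕ} (w : Fin (k + 1) → ℝ) (m : ℕ) : ℝ :=
  ∑ i : Fin (k + 1), if (i : ℕ) < m then w i else 0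

/-- The least concave majorant of `cumulativePoints w`, evaluated at `m - 1`. -/
def majorant {k : ℕ} (w : Fin (k + 1) → ℝ) (m : ℕ) : ℝ :=
  leastConcaveMajorant (Set.Icc (-1) (k : ℝ)) (cumulativePoints w) ((m : ℝ) - 1)

section

variable {k : ℕ} {w : Fin (k + 1) → ℝ}

theorem gren_apply (w : Fin (k + 1) → ℝ) (i : Fin (k + 1)) :
    gren w i = majorant w (i + 1) - majorant w i := by
  simp [gren, majorant]

theorem cumulative_zero : cumulative w 0 = 0 := by simp [cumulative]

theorem cumulative_succ_sub (i : Fin (k + 1)) :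
    cumulative w (i + 1) - cumulative w i = w i := by
  rw [cumulative, cumulative, ← Finset.sum_sub_distrib, Finset.sum_eq_single i]
  · simp
  · intro j _ hj
    have : (j : ℕ) ≠ i := fun h => hj (Fin.ext h)
    by_cases h : (j : ℕ) < i
    · simp [h, Nat.lt_succ_of_lt h]
    · have : ¬ (j : ℕ) < i + 1 := by omega
      simp [h, this]
  · simp

theorem cumulative_mono (hw : ∀ i, 0 ≤ w i) : Monotone (cumulative w) := by
  intro a b hab
  refine Finset.sum_le_sum fun i _ => ?_
  by_cases h : (i : ℕ) < a
  · simp [h, h.trans_le hab]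
  · by_cases h' : (i : ℕ) < b <;> simp [h, h', hw i]

theorem cumulative_nonneg (hw : ∀ i, 0 ≤ w i) (m : ℕ) : 0 ≤ cumulative w m :=
  cumulative_zero (w := w) ▸ cumulative_mono hw (Nat.zero_le m)

/-- `g` is a concave majorant of `cumulativePoints w`. -/
def IsConcaveMajorant (w : Fin (k + 1) → ℝ) (g : ℝ → ℝ) : Prop :=
  ConcaveOn ℝ (Set.Icc (-1) (k : ℝ)) g ∧ ∀ m : ℕ, m ≤ k + 1 → cumulative w m ≤ g ((m : ℝ) - 1)

theorem leastConcaveMajorant_cumulativePoints (t : ℝ) :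
    leastConcaveMajorant (Set.Icc (-1) (k : ℝ)) (cumulativePoints w) t =
      sInf {v | ∃ g, IsConcaveMajorant w g ∧ v = g t} := by
  unfold leastConcaveMajorant
  congr 1
  ext v
  refine exists_congr fun g => ?_
  rw [IsConcaveMajorant, and_assoc]
  refine and_congr_right fun _ => and_congr_left fun _ => ⟨fun h m hm => ?_, ?_⟩
  · exact h _ ⟨m, hm, rfl⟩
  · rintro h q ⟨m, hm, rfl⟩
    exact h m hm

theorem isConcaveMajorant_affine {a b : ℝ}
    (h : ∀ m : ℕ, m ≤ k + 1 → cumulative w m ≤ a + b * m) :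
    IsConcaveMajorant w fun t => a + b * (t + 1) := by
  refine ⟨⟨convex_Icc _ _, fun x _ y _ c d _ _ hcd => le_of_eq ?_⟩, fun m hm => ?_⟩
  · simp only [smul_eq_mul]
    linear_combination (a + b) * hcd
  · simpa using h m hm

theorem isConcaveMajorant_const (hw : ∀ i, 0 ≤ w i) :
    IsConcaveMajorant w fun t => cumulative w (k + 1) + 0 * (t + 1) :=
  isConcaveMajorant_affine fun m hm => by simpa using cumulative_mono hw hm

/-- Concavity puts `g` above the smaller of its two endpoint values. This bounds the set of majorant
values below, so that the real `sInf` is a genuine infimum; `isConcaveMajorant_const` makes the set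
nonempty. -/
theorem IsConcaveMajorant.nonneg (hw : ∀ i, 0 ≤ w i) {g : ℝ → ℝ} (hg : IsConcaveMajorant w g)
    {t : ℝ} (ht : t ∈ Set.Icc (-1) (k : ℝ)) : 0 ≤ g t := by
  have hk : (-1 : ℝ) ≤ k := (by norm_num : (-1 : ℝ) ≤ 0).trans k.cast_nonneg
  refine le_trans (le_min ?_ ?_) (hg.1.min_le_of_mem_Icc (Set.left_mem_Icc.2 hk)
    (Set.right_mem_Icc.2 hk) ht)
  · simpa [cumulative_zero] using hg.2 0 (Nat.zero_le _)
  · simpa using (cumulative_nonneg hw _).trans (hg.2 (k + 1) le_rfl)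

theorem leastConcaveMajorant_le (hw : ∀ i, 0 ≤ w i) {g : ℝ → ℝ} (hg : IsConcaveMajorant w g)
    {t : ℝ} (ht : t ∈ Set.Icc (-1) (k : ℝ)) :
    leastConcaveMajorant (Set.Icc (-1) (k : ℝ)) (cumulativePoints w) t ≤ g t := by
  rw [leastConcaveMajorant_cumulativePoints]
  refine csInf_le ⟨0, ?_⟩ ⟨g, hg, rfl⟩
  rintro v ⟨h, hh, rfl⟩
  exact hh.nonneg hw ht

theorem le_leastConcaveMajorant (hw : ∀ i, 0 ≤ w i) {t c : ℝ}
    (h : ∀ g, IsConcaveMajorant w g → c ≤ g t) :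
    c ≤ leastConcaveMajorant (Set.Icc (-1) (k : ℝ)) (cumulativePoints w) t := by
  rw [leastConcaveMajorant_cumulativePoints]
  refine le_csInf ⟨_, _, isConcaveMajorant_const hw, rfl⟩ ?_
  rintro v ⟨g, hg, rfl⟩
  exact h g hg

theorem concaveOn_leastConcaveMajorant (hw : ∀ i, 0 ≤ w i) :
    ConcaveOn ℝ (Set.Icc (-1) (k : ℝ))
      (leastConcaveMajorant (Set.Icc (-1) (k : ℝ)) (cumulativePoints w)) := by
  refine ⟨convex_Icc _ _, fun x hx y hy a b ha hb hab => ?_⟩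
  refine le_leastConcaveMajorant hw fun g hg => le_trans ?_ (hg.1.2 hx hy ha hb hab)
  exact add_le_add (mul_le_mul_of_nonneg_left (leastConcaveMajorant_le hw hg hx) ha)
    (mul_le_mul_of_nonneg_left (leastConcaveMajorant_le hw hg hy) hb)

theorem natCast_sub_one_mem_Icc {m : ℕ} (hm : m ≤ k + 1) :
    (m : ℝ) - 1 ∈ Set.Icc (-1) (k : ℝ) := by
  have : (m : ℝ) ≤ k + 1 := by exact_mod_cast hm
  exact ⟨by linarith [(m.cast_nonneg : (0 : ℝ) ≤ m)], by linarith⟩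

theorem cumulative_le_majorant (hw : ∀ i, 0 ≤ w i) {m : ℕ} (hm : m ≤ k + 1) :
    cumulative w m ≤ majorant w m :=
  le_leastConcaveMajorant hw fun _ hg => hg.2 m hm

theorem majorant_le_affine (hw : ∀ i, 0 ≤ w i) {a b : ℝ}
    (h : ∀ m : ℕ, m ≤ k + 1 → cumulative w m ≤ a + b * m) {m : ℕ} (hm : m ≤ k + 1) :
    majorant w m ≤ a + b * m := by
  simpa [majorant] using
    leastConcaveMajorant_le hw (isConcaveMajorant_affine h) (natCast_sub_one_mem_Icc hm)

theorem majorant_slope_anti (hw : ∀ i, 0 ≤ w i) {a b c : ℕ} (hab : a < b) (hbc : b < c)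
    (hc : c ≤ k + 1) :
    (majorant w c - majorant w b) / ((c : ℝ) - b) ≤
      (majorant w b - majorant w a) / ((b : ℝ) - a) := by
  have h1 : (a : ℝ) < b := by exact_mod_cast hab
  have h2 : (b : ℝ) < c := by exact_mod_cast hbc
  have := (concaveOn_leastConcaveMajorant hw).slope_anti_adjacent
    (natCast_sub_one_mem_Icc ((hab.trans hbc).le.trans hc)) (natCast_sub_one_mem_Icc hc)
    (sub_lt_sub_right h1 1) (sub_lt_sub_right h2 1)
  simpa [majorant] using this

theorem majorant_zero (hw : ∀ i, 0 ≤ w i) : majorant w 0 = 0 := by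
  refine le_antisymm ?_ (cumulative_zero (w := w) ▸ cumulative_le_majorant hw (Nat.zero_le _))
  -- The line through the origin whose slope is the total mass: for `m ≥ 1` it is already at least
  -- the total.
  have := majorant_le_affine hw (a := 0) (b := cumulative w (k + 1)) (fun m hm => ?_)
    (Nat.zero_le (k + 1))
  · simpa using this
  · rcases Nat.eq_zero_or_pos m with rfl | h
    · simp [cumulative_zero]
    · have h1 : (1 : ℝ) ≤ m := by exact_mod_cast h
      nlinarith [cumulative_mono hw hm, cumulative_nonneg hw (k + 1)]

theorem majorant_last (hw : ∀ i, 0 ≤ w i) : majorant w (k + 1) = cumulative w (k + 1) := by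
  refine le_antisymm ?_ (cumulative_le_majorant hw le_rfl)
  have := majorant_le_affine hw (a := cumulative w (k + 1)) (b := 0)
    (fun m hm => by simpa using cumulative_mono hw hm) le_rfl
  simpa using this

theorem majorant_le_last (hw : ∀ i, 0 ≤ w i) {m : ℕ} (hm : m ≤ k + 1) :
    majorant w m ≤ majorant w (k + 1) := by
  rw [majorant_last hw]
  simpa using majorant_le_affine hw (a := cumulative w (k + 1)) (b := 0)
    (fun m hm => by simpa using cumulative_mono hw hm) hm

theorem gren_nonneg (hw : ∀ i, 0 ≤ w i) (i : Fin (k + 1)) : 0 ≤ gren w i := by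
  rw [gren_apply]
  have hi : (i : ℕ) + 1 ≤ k + 1 := i.isLt
  rcases hi.eq_or_lt with h | h
  · rw [h]
    exact sub_nonneg.2 (majorant_le_last hw (by omega))
  · have h1 := majorant_slope_anti hw (Nat.lt_succ_self (i : ℕ)) h le_rfl
    have h2 : (0 : ℝ) < (k + 1 : ℕ) - ((i : ℕ).succ : ℕ) := sub_pos.2 (by exact_mod_cast h)
    have h3 : (0 : ℝ) ≤ majorant w (k + 1) - majorant w (i : ℕ).succ :=
      sub_nonneg.2 (majorant_le_last hw hi)
    have h4 := (div_nonneg h3 h2.le).trans h1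
    simpa using h4

/-- The least concave majorant is linear around every point at which it is not attained. -/
theorem majorant_linear_of_lt (hw : ∀ i, 0 ≤ w i) {m : ℕ} (hm : m + 1 < k + 1)
    (hlt : cumulative w (m + 1) < majorant w (m + 1)) :
    majorant w (m + 2) - majorant w (m + 1) = majorant w (m + 1) - majorant w m := by
  have hconc := majorant_slope_anti hw (Nat.lt_succ_self m) (Nat.lt_succ_self (m + 1)) hm
  simp only [Nat.cast_succ, add_sub_cancel_left, div_one] at hconc
  refine le_antisymm (by simpa using hconc) ?_
  by_contra! hstrict
  -- `b` is the slope of the chord from `m` to `m + 2`, and `δ` raises that chord just enough to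
  -- clear the point at `m + 1`. Outside `[m, m + 2]` the extended chord dominates the majorant by
  -- concavity. The raised line thus dominates all the points, yet lies strictly below the majorant
  -- at `m + 1`.
  set b := (majorant w (m + 2) - majorant w m) / 2 with hb
  set δ := max 0 (cumulative w (m + 1) - (majorant w m + b)) with hδ
  have hle := majorant_le_affine hw (a := majorant w m - b * m + δ) (b := b) (fun j hj => ?_) hm.le
  · push_cast at hle
    have h1 : majorant w (m + 1) ≤ majorant w m + b + δ := by linarith
    rcases max_choice 0 (cumulative w (m + 1) - (majorant w m + b)) with h | h <;>
      rw [← hδ] at h <;> rw [h] at h1 <;> linarith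
  · have hδ0 : 0 ≤ δ := le_max_left _ _
    have hδ1 : cumulative w (m + 1) - (majorant w m + b) ≤ δ := le_max_right _ _
    have hCj := cumulative_le_majorant hw hj
    rcases lt_trichotomy j (m + 1) with h | rfl | h
    · rcases (Nat.lt_succ_iff.1 h).eq_or_lt with rfl | h
      · linarith
      · have := majorant_slope_anti hw h (by omega : m < m + 2) hm
        have hpos : (0 : ℝ) < m - j := sub_pos.2 (by exact_mod_cast h)
        rw [le_div_iff₀ hpos] at this
        push_cast at this
        rw [show (m : ℝ) + 2 - m = 2 by ring, ← hb] at this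
        linarith
    · push_cast
      linarith
    · rcases (Nat.succ_le_of_lt h).eq_or_lt with rfl | h
      · push_cast
        linarith
      · have h : m + 2 < j := h
        have := majorant_slope_anti hw (by omega : m < m + 2) h hj
        have hpos : (0 : ℝ) < j - (m + 2 : ℕ) := sub_pos.2 (by exact_mod_cast h)
        rw [div_le_iff₀ hpos] at this
        push_cast at this
        rw [show (m : ℝ) + 2 - m = 2 by ring, ← hb] at this
        linarith

theorem majorant_eq_cumulative (hw : ∀ i, 0 ≤ w i) (hanti : Antitone w) {m : ℕ} (hm : m ≤ k + 1) :
    majorant w m = cumulative w m := by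
  refine le_antisymm ?_ (cumulative_le_majorant hw hm)
  rcases hm.eq_or_lt with rfl | hm'
  · exact (majorant_last hw).le
  set i : Fin (k + 1) := ⟨m, hm'⟩ with hi
  -- A supporting line at `m`: the increments of the partial sums are at least `w i` before `m` and
  -- at most `w i` from `m` on.
  have := majorant_le_affine hw (a := cumulative w m - w i * m) (b := w i) (fun j hj => ?_) hm
  · linarith
  · rcases le_total j m with h | h
    · induction h using Nat.decreasingInduction with
      | self => linarith
      | of_succ l hl ih =>
        have ih := ih (by omega)
        have h1 := cumulative_succ_sub (w := w) ⟨l, by omega⟩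
        have h2 : w i ≤ w ⟨l, by omega⟩ := hanti (Fin.mk_le_mk.2 hl.le)
        push_cast at ih
        simp only at h1
        linarith
    · induction j, h using Nat.le_induction with
      | base => linarith
      | succ l hl ih =>
        have ih := ih (by omega)
        have h1 := cumulative_succ_sub (w := w) ⟨l, by omega⟩
        have h2 : w ⟨l, by omega⟩ ≤ w i := hanti (Fin.mk_le_mk.2 hl)
        push_cast
        simp only at h1
        linarith

theorem gren_eq_self (hw : ∀ i, 0 ≤ w i) (hanti : Antitone w) : gren w = w := by
  funext i
  rw [gren_apply, majorant_eq_cumulative hw hanti (by omega),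
    majorant_eq_cumulative hw hanti (by omega), cumulative_succ_sub]

/-! ### Contraction properties of the slopes of the least concave majorant -/

/-- Abel summation: the two sides differ by the sum of the terms in `h`. The left side is the
boundary term, which vanishes in the application. -/
theorem mul_le_sum_range_mul_sub {A s : ℕ → ℝ} (h0 : A 0 = 0) (n : ℕ)
    (h : ∀ m, m < n → 0 ≤ (s m - s (m + 1)) * A (m + 1)) :
    s n * A (n + 1) ≤ ∑ i ∈ Finset.range (n + 1), s i * (A (i + 1) - A i) := by
  induction n with
  | zero => simp [h0]
  | succ n ih =>
    rw [Finset.sum_range_succ]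
    have := ih fun m hm => h m (by omega)
    linarith [h n (by omega)]

theorem sum_mul_sub_gren_nonneg (hw : ∀ i, 0 ≤ w i) {s : Fin (k + 1) → ℝ}
    (hs : ∀ i j : Fin (k + 1), (j : ℕ) = i + 1 → gren w i = gren w j → s i ≤ s j) :
    0 ≤ ∑ i, s i * (w i - gren w i) := by
  have key := mul_le_sum_range_mul_sub (A := fun m => cumulative w m - majorant w m)
    (s := extendZero s) (by simp [cumulative_zero, majorant_zero hw]) k (fun m hm => ?_)
  · simp only [majorant_last hw, sub_self, mul_zero] at key
    refine key.trans_eq ?_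
    rw [← Fin.sum_univ_eq_sum_range
      (fun i => extendZero s i * (cumulative w (i + 1) - majorant w (i + 1) -
        (cumulative w i - majorant w i)))]
    refine Finset.sum_congr rfl fun i _ => ?_
    rw [← cumulative_succ_sub (w := w) i, gren_apply, extendZero, dif_pos i.isLt]
    ring
  · have hle := cumulative_le_majorant hw (m := m + 1) (by omega)
    rcases hle.eq_or_lt with h | h
    · simp [h]
    · refine mul_nonneg_of_nonpos_of_nonpos ?_ (sub_nonpos.2 hle)
      rw [extendZero, extendZero, dif_pos (by omega), dif_pos (by omega), sub_nonpos]
      refine hs _ _ rfl ?_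
      rw [gren_apply, gren_apply]
      exact (majorant_linear_of_lt hw (by omega) h).symm

theorem convexCloser_gren (hw : ∀ i, 0 ≤ w i) {v : Fin (k + 1) → ℝ} (hv : Antitone v) :
    ConvexCloser (gren w) w v := by
  intro f hf
  obtain ⟨s, hs, hsub⟩ := hf.exists_monotone_subgradient
  have h1 := sum_mul_sub_gren_nonneg hw (s := fun i => s (gren w i - v i)) fun i j hij hg => by
    refine hs ?_
    rw [hg]
    exact sub_le_sub_left (hv (Fin.le_def.2 (by omega))) _
  have h2 : ∑ i, (f (gren w i - v i) + s (gren w i - v i) * (w i - gren w i)) ≤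
      ∑ i, f (w i - v i) :=
    Finset.sum_le_sum fun i _ => by simpa using hsub (gren w i - v i) (w i - v i)
  rw [Finset.sum_add_distrib] at h2
  linarith

theorem sum_gren (hw : ∀ i, 0 ≤ w i) : ∑ i, gren w i = ∑ i, w i := by
  have h1 := sum_mul_sub_gren_nonneg hw (s := fun _ => 1) fun _ _ _ _ => le_rfl
  have h2 := sum_mul_sub_gren_nonneg hw (s := fun _ => -1) fun _ _ _ _ => le_rfl
  simp only [one_mul, neg_one_mul, Finset.sum_neg_distrib, Finset.sum_sub_distrib] at h1 h2
  linarith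

/-- Follow a flat stretch of the majorant to the left until it touches the partial sums. They have
reached the majorant's height there, and being nondecreasing they cannot grow along the stretch.
This makes division by `√(gren w i)` harmless in the Hellinger bound. -/
theorem eq_zero_of_gren_eq_zero (hw : ∀ i, 0 ≤ w i) (i : Fin (k + 1)) (h : gren w i = 0) :
    w i = 0 := by
  rw [gren_apply] at h
  have hmain : ∀ m : ℕ, m < k + 1 → majorant w (m + 1) = majorant w m →
      majorant w (m + 1) ≤ cumulative w m := by
    intro m hm heq
    induction m with
    | zero => rw [heq, majorant_zero hw, cumulative_zero]
    | succ m ih =>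
      rcases (cumulative_le_majorant hw hm.le).eq_or_lt with h | h
      · rw [heq, h]
      · have hlin := majorant_linear_of_lt hw hm h
        have := ih (by omega) (by linarith)
        rw [heq]
        exact this.trans (cumulative_mono hw (Nat.le_succ m))
  have h1 := hmain i i.isLt (by linarith)
  have h2 := cumulative_le_majorant hw (m := (i : ℕ) + 1) i.isLt
  have h3 := cumulative_succ_sub (w := w) i
  linarith [hw i]

theorem sum_sq_sqrt_gren_le (hw : ∀ i, 0 ≤ w i) {v : Fin (k + 1) → ℝ} (hv : Antitone v)
    (hv0 : ∀ i, 0 ≤ v i) :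
    ∑ i, (√(gren w i) - √(v i)) ^ 2 ≤ ∑ i, (√(w i) - √(v i)) ^ 2 := by
  have h1 := sum_mul_sub_gren_nonneg hw (s := fun i => -(√(v i) / √(gren w i)))
    fun i j hij hg => by
      rw [hg]
      exact neg_le_neg (div_le_div_of_nonneg_right
        (Real.sqrt_le_sqrt (hv (Fin.le_def.2 (by omega)))) (Real.sqrt_nonneg _))
  -- Tangent line of the concave square root at `gren w i`, multiplied by `2 * √(v i)`.
  have h2 : ∀ i, 2 * (√(w i) * √(v i)) ≤
      2 * (√(gren w i) * √(v i)) + √(v i) / √(gren w i) * (w i - gren w i) := by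
    intro i
    rcases (gren_nonneg hw i).eq_or_lt with h | h
    · simp [eq_zero_of_gren_eq_zero hw i h.symm, ← h]
    · have hg := Real.sqrt_pos.2 h
      have e1 := Real.mul_self_sqrt h.le
      have e2 := Real.mul_self_sqrt (hw i)
      have e3 : √(v i) / √(gren w i) * √(gren w i) = √(v i) := div_mul_cancel₀ _ hg.ne'
      have e4 : √(v i) / √(gren w i) * (w i - gren w i) - 2 * (√(w i) * √(v i)) +
          2 * (√(gren w i) * √(v i)) = √(v i) / √(gren w i) * (√(w i) - √(gren w i)) ^ 2 := by
        linear_combination (-(√(v i) / √(gren w i))) * (e2 - e1) +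
          2 * (√(w i) - √(gren w i)) * e3
      have : 0 ≤ √(v i) / √(gren w i) * (√(w i) - √(gren w i)) ^ 2 := by positivity
      linarith
  have h3 := Finset.sum_le_sum fun i (_ : i ∈ Finset.univ) => h2 i
  rw [Finset.sum_add_distrib] at h3
  have h4 : ∀ u : Fin (k + 1) → ℝ, (∀ i, 0 ≤ u i) → ∑ i, (√(u i) - √(v i)) ^ 2 =
      ∑ i, u i + ∑ i, v i - ∑ i, 2 * (√(u i) * √(v i)) := by
    intro u hu
    rw [← Finset.sum_add_distrib, ← Finset.sum_sub_distrib]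
    refine Finset.sum_congr rfl fun i _ => ?_
    rw [sub_sq, Real.sq_sqrt (hu i), Real.sq_sqrt (hv0 i)]
    ring
  rw [h4 _ (gren_nonneg hw), h4 _ hw, sum_gren hw]
  simp only [neg_mul, Finset.sum_neg_distrib] at h1
  linarith

end

/-! ### Distances of vectors extended by zero -/

@[simp]
theorem extendZero_val {k : ℕ} (u : Fin (k + 1) → ℝ) (i : Fin (k + 1)) :
    extendZero u i = u i := dif_pos i.isLt

theorem extendZero_of_le {k : ℕ} (u : Fin (k + 1) → ℝ) {x : ℕ} (hx : k + 1 ≤ x) :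
    extendZero u x = 0 := dif_neg hx.not_gt

/-- The tail does not depend on `u`, so it is common to the estimators being compared. -/
theorem tsum_extendZero {k : ℕ} (u : Fin (k + 1) → ℝ) (p : ℕ → ℝ) (F : ℝ → ℝ → ℝ≥0∞) :
    ∑' x, F (extendZero u x) (p x) =
      ∑ i, F (u i) (p i) + ∑' x, F 0 (p (x + (k + 1))) := by
  rw [← Summable.sum_add_tsum_nat_add' (k := k + 1) ENNReal.summable,
    ← Fin.sum_univ_eq_sum_range (fun x => F (extendZero u x) (p x))]
  simp only [extendZero_val, extendZero_of_le u (Nat.le_add_left _ _)]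

theorem convexOn_abs_rpow {r : ℝ} (hr : 1 ≤ r) :
    ConvexOn ℝ Set.univ fun x : ℝ => |x| ^ r := by
  have him : (fun x : ℝ => |x|) '' Set.univ ⊆ Set.Ici 0 := by
    rintro _ ⟨x, _, rfl⟩
    exact abs_nonneg x
  have habs : ConvexOn ℝ Set.univ fun x : ℝ => |x| := convexOn_univ_norm
  refine ConvexOn.comp (g := fun x : ℝ => x ^ r) ?_ habs ?_
  · refine (convexOn_rpow hr).subset him ?_
    rw [Set.image_univ]
    exact (isPreconnected_range continuous_abs).ordConnected.convex
  · intro a ha b _ hab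
    exact Real.rpow_le_rpow (him ha) hab (zero_le_one.trans hr)

/-- With `t` the sup distance of `w`, the total cost of `w` is zero, so every term for `u` vanishes
too. -/
theorem convexOn_max_abs_sub (t : ℝ) : ConvexOn ℝ Set.univ fun x : ℝ => max (|x| - t) 0 := by
  have habs : ConvexOn ℝ Set.univ fun x : ℝ => |x| := convexOn_univ_norm
  exact (habs.sub (concaveOn_const t convex_univ)).sup (convexOn_const 0 convex_univ)

theorem ConvexCloser.abs_sub_le {m : ℕ} {u w v : Fin m → ℝ} (h : ConvexCloser u w v) {t : ℝ}
    (ht : ∀ i, |w i - v i| ≤ t) (i : Fin m) : |u i - v i| ≤ t := by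
  have h1 := h _ (convexOn_max_abs_sub t)
  have h2 : ∑ i, max (|w i - v i| - t) 0 = 0 :=
    Finset.sum_eq_zero fun i _ => max_eq_right (sub_nonpos.2 (ht i))
  have h3 := Finset.single_le_sum (f := fun i => max (|u i - v i| - t) 0)
    (fun i _ => le_max_right _ _) (Finset.mem_univ i)
  have h4 := le_max_left (|u i - v i| - t) 0
  linarith

theorem ellDist_extendZero_le {k : ℕ} {u w : Fin (k + 1) → ℝ} {p : ℕ → ℝ}
    (h : ConvexCloser u w fun i => p i) {r : ℝ≥0∞} (hr : 1 ≤ r) :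
    ellDist r (extendZero u) p ≤ ellDist r (extendZero w) p := by
  by_cases hr' : r = ∞
  · simp only [ellDist, if_pos hr']
    obtain ⟨j, hj⟩ := Finite.exists_max fun i => |w i - p i|
    refine iSup_le fun x => ?_
    by_cases hx : x < k + 1
    · refine le_iSup_of_le (j : ℕ) (ENNReal.ofReal_le_ofReal ?_)
      rw [extendZero_val w j, extendZero, dif_pos hx]
      exact h.abs_sub_le hj ⟨x, hx⟩
    · refine le_iSup_of_le x (ENNReal.ofReal_le_ofReal ?_)
      rw [extendZero_of_le u (not_lt.1 hx), extendZero_of_le w (not_lt.1 hx)]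
  · simp only [ellDist, if_neg hr']
    have hr1 : 1 ≤ r.toReal := by
      rwa [← ENNReal.ofReal_le_iff_le_toReal hr', ENNReal.ofReal_one]
    refine ENNReal.rpow_le_rpow ?_ (by positivity)
    rw [tsum_extendZero u p fun a b => ENNReal.ofReal |a - b| ^ r.toReal,
      tsum_extendZero w p fun a b => ENNReal.ofReal |a - b| ^ r.toReal]
    refine add_le_add_left ?_ _
    simp only [ENNReal.ofReal_rpow_of_nonneg (abs_nonneg _) (zero_le_one.trans hr1)]
    rw [← ENNReal.ofReal_sum_of_nonneg fun _ _ => by positivity,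
      ← ENNReal.ofReal_sum_of_nonneg fun _ _ => by positivity]
    exact ENNReal.ofReal_le_ofReal (h _ (convexOn_abs_rpow hr1))

theorem hellinger_extendZero_le {k : ℕ} {u w : Fin (k + 1) → ℝ} {p : ℕ → ℝ}
    (h : ∑ i, (√(u i) - √(p i)) ^ 2 ≤ ∑ i, (√(w i) - √(p i)) ^ 2) :
    hellinger (extendZero u) p ≤ hellinger (extendZero w) p := by
  refine ENNReal.rpow_le_rpow ?_ (by positivity)
  rw [tsum_extendZero u p fun a b => ENNReal.ofReal ((√a - √b) ^ 2),
    tsum_extendZero w p fun a b => ENNReal.ofReal ((√a - √b) ^ 2)]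
  refine mul_le_mul_right (add_le_add_left ?_ _) _
  rw [← ENNReal.ofReal_sum_of_nonneg fun _ _ => sq_nonneg _,
    ← ENNReal.ofReal_sum_of_nonneg fun _ _ => sq_nonneg _]
  exact ENNReal.ofReal_le_ofReal h

/-! ### The empirical estimator -/

section

variable {n : ℕ} (s : Fin n → ℕ)

theorem empirical_nonneg (x : ℕ) : 0 ≤ empirical s x :=
  mul_nonneg (by positivity) (Finset.sum_nonneg fun _ _ => by split_ifs <;> norm_num)

theorem empirical_eq_zero {x : ℕ} (h : ∀ i, s i ≠ x) : empirical s x = 0 := by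
  simp [empirical, h]

theorem le_sampleMax (i : Fin n) : s i ≤ sampleMax s := Finset.le_sup (Finset.mem_univ i)

theorem extendZero_empiricalVec : extendZero (empiricalVec s) = empirical s := by
  funext x
  by_cases hx : x < sampleMax s + 1
  · simp [extendZero, hx, empiricalVec]
  · rw [extendZero, dif_neg hx, empirical_eq_zero]
    exact fun i hi => hx (Nat.lt_succ_of_le (hi ▸ le_sampleMax s i))

theorem antitone_restrict {p : ℕ → ℝ} (hp : Antitone p) (k : ℕ) :
    Antitone fun i : Fin k => p i := fun _ _ h => hp h

theorem hellinger_grenander_le {p : ℕ → ℝ} (hp : Antitone p) (hp0 : ∀ x, 0 ≤ p x) :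
    hellinger (grenander s) p ≤ hellinger (empirical s) p := by
  rw [← extendZero_empiricalVec]
  exact hellinger_extendZero_le (sum_sq_sqrt_gren_le (fun i => empirical_nonneg s i)
    (antitone_restrict hp _) fun i => hp0 i)

theorem hellinger_rearrangement_le {p : ℕ → ℝ} (hp : Antitone p) :
    hellinger (rearrangement s) p ≤ hellinger (empirical s) p := by
  rw [← extendZero_empiricalVec]
  exact hellinger_extendZero_le (sum_sq_sqrt_rear_le _ (antitone_restrict hp _))

theorem ellDist_grenander_le {p : ℕ → ℝ} (hp : Antitone p) {r : ℝ≥0∞} (hr : 1 ≤ r) :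
    ellDist r (grenander s) p ≤ ellDist r (empirical s) p := by
  rw [← extendZero_empiricalVec]
  exact ellDist_extendZero_le
    (convexCloser_gren (fun i => empirical_nonneg s i) (antitone_restrict hp _)) hr

theorem ellDist_rearrangement_le {p : ℕ → ℝ} (hp : Antitone p) {r : ℝ≥0∞} (hr : 1 ≤ r) :
    ellDist r (rearrangement s) p ≤ ellDist r (empirical s) p := by
  rw [← extendZero_empiricalVec]
  exact ellDist_extendZero_le (convexCloser_rear _ (antitone_restrict hp _)) hr

/-- For a cost relative to a constant, sorting does not change the sum. -/
theorem sum_rear {k : ℕ} (w : Fin (k + 1) → ℝ) {v : Fin (k + 1) → ℝ} {c : ℝ} (hv : ∀ i, v i = c)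
    (F : ℝ → ℝ → ℝ) : ∑ i, F (rear w i) (v i) = ∑ i, F (w i) (v i) := by
  simp only [hv, rear]
  exact Equiv.sum_comp (Tuple.sort (OrderDual.toDual ∘ w)) fun i => F (w i) c

variable {s} {p : ℕ → ℝ} {c : ℝ}

theorem hellinger_rearrangement_eq (hc : ∀ x, x ≤ sampleMax s → p x = c) :
    hellinger (rearrangement s) p = hellinger (empirical s) p := by
  have h := sum_rear (empiricalVec s) (v := fun i => p i)
    (fun i => hc i (Nat.lt_succ_iff.1 i.isLt)) fun a b => (√a - √b) ^ 2
  rw [← extendZero_empiricalVec]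
  exact le_antisymm (hellinger_extendZero_le h.le) (hellinger_extendZero_le h.ge)

theorem ellDist_rearrangement_eq (hc : ∀ x, x ≤ sampleMax s → p x = c)
    {r : ℝ≥0∞} (hr : 1 ≤ r) :
    ellDist r (rearrangement s) p = ellDist r (empirical s) p := by
  have h := fun f : ℝ → ℝ => sum_rear (empiricalVec s) (v := fun i => p i)
    (fun i => hc i (Nat.lt_succ_iff.1 i.isLt)) fun a b => f (a - b)
  rw [← extendZero_empiricalVec]
  exact le_antisymm (ellDist_extendZero_le (fun f _ => (h f).le) hr)
    (ellDist_extendZero_le (fun f _ => (h f).ge) hr)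

end

/-! ### Monotone empirical estimators -/

theorem rearrangement_eq_empirical {n : ℕ} {s : Fin n → ℕ} (h : Antitone (empirical s)) :
    rearrangement s = empirical s := by
  rw [rearrangement, rear_eq_self (w := empiricalVec s) (antitone_restrict h _), extendZero_empiricalVec]

theorem grenander_eq_empirical {n : ℕ} {s : Fin n → ℕ} (h : Antitone (empirical s)) :
    grenander s = empirical s := by
  rw [grenander, gren_eq_self (w := empiricalVec s) (fun i => empirical_nonneg s i) (antitone_restrict h _),
    extendZero_empiricalVec]

theorem antitone_empirical_iff {n y : ℕ} {s : Fin n → ℕ} (hs : ∀ i, s i ≤ y) :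
    Antitone (empirical s) ↔ DecreasingUpTo y (empirical s) := by
  refine ⟨fun h x _ => h (Nat.le_succ x), fun h => antitone_nat_of_succ_le fun x => ?_⟩
  rcases lt_or_ge x y with hx | hx
  · exact h x hx
  · rw [empirical_eq_zero s fun i hi => by have := hs i; omega]
    exact empirical_nonneg s x

/-- The indicator function of the point `x`. -/
def pointIndicator (x m : ℕ) : ℝ := if m = x then 1 else 0

theorem empirical_eq_inv_mul_sum {n : ℕ} (s : Fin n → ℕ) (x : ℕ) :
    empirical s x = (n : ℝ)⁻¹ * ∑ i : Fin n, pointIndicator x (s i) := rfl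

theorem empirical_comp_perm {n : ℕ} (τ : Equiv.Perm ℕ) (s : Fin n → ℕ) (x : ℕ) :
    empirical (fun i => τ.symm (s i)) x = empirical s (τ x) := by
  simp only [empirical, Equiv.symm_apply_eq]

theorem uniformMass_of_le {y x : ℕ} (h : x ≤ y) : uniformMass y x = 1 / ((y : ℝ) + 1) := if_pos h

theorem uniformMass_of_lt {y x : ℕ} (h : y < x) : uniformMass y x = 0 := if_neg h.not_ge

theorem empirical_sample {Ω : Type*} {X : ℕ → Ω → ℕ} (n : ℕ) (ω : Ω) (x : ℕ) :
    empirical (sample X n ω) x =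
      (∑ i ∈ Finset.range n, pointIndicator x (X i ω)) / n := by
  rw [empirical_eq_inv_mul_sum, inv_mul_eq_div,
    ← Fin.sum_univ_eq_sum_range fun i => pointIndicator x (X i ω)]
  rfl

section

variable {Ω : Type*} [MeasurableSpace Ω] {P : Measure Ω} {X : ℕ → Ω → ℕ} {p : ℕ → ℝ}

/-! ### Laws and supports of the observations -/

namespace IsIIDSample

theorem measurable_sample (hX : IsIIDSample P X p) (n : ℕ) : Measurable (sample X n) :=
  measurable_pi_lambda _ fun i => hX.measurable i

theorem measurableSet_sample (hX : IsIIDSample P X p) (n : ℕ) (Q : (Fin n → ℕ) → Prop) :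
    MeasurableSet {ω | Q (sample X n ω)} :=
  hX.measurable_sample n (MeasurableSet.of_discrete (s := {s | Q s}))

theorem integral_pointIndicator (hX : IsIIDSample P X p) (i x : ℕ) :
    ∫ ω, pointIndicator x (X i ω) ∂P = p x := by
  have hm : MeasurableSet {ω | X i ω = x} := hX.measurable i (measurableSet_singleton x)
  rw [← hX.law i x, ← integral_indicator_one hm]
  refine integral_congr_ae (Eventually.of_forall fun ω => ?_)
  simp [pointIndicator, Set.indicator_apply]

variable [IsProbabilityMeasure P]

theorem map_eq_map_of_law {Y Z : Ω → ℕ} (hY : Measurable Y) (hZ : Measurable Z)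
    (h : ∀ x, P.real {ω | Y ω = x} = P.real {ω | Z ω = x}) : P.map Y = P.map Z := by
  refine Measure.ext_of_singleton fun x => ?_
  rw [Measure.map_apply hY (measurableSet_singleton x),
    Measure.map_apply hZ (measurableSet_singleton x)]
  exact (measureReal_eq_measureReal_iff (measure_ne_top _ _) (measure_ne_top _ _)).1 (h x)

theorem identDistrib (hX : IsIIDSample P X p) (i j : ℕ) : IdentDistrib (X i) (X j) P P :=
  ⟨(hX.measurable i).aemeasurable, (hX.measurable j).aemeasurable,
    map_eq_map_of_law (hX.measurable i) (hX.measurable j) fun x => by rw [hX.law, hX.law]⟩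

theorem ae_le (hX : IsIIDSample P X p) {y : ℕ} (hp : ∀ x, y < x → p x = 0) :
    ∀ᵐ ω ∂P, ∀ i, X i ω ≤ y := by
  have h : ∀ i x, y < x → ∀ᵐ ω ∂P, X i ω ≠ x := by
    intro i x hx
    have h0 := hX.law i x
    rw [hp x hx, measureReal_eq_zero_iff] at h0
    simpa [ae_iff] using h0
  have h' : ∀ᵐ ω ∂P, ∀ i x, y < x → X i ω ≠ x :=
    ae_all_iff.2 fun i => ae_all_iff.2 fun x => ae_all_iff.2 fun hx => h i x hx
  filter_upwards [h'] with ω hω i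
  by_contra! hlt
  exact hω i _ hlt rfl

theorem measureReal_antitone_eq (hX : IsIIDSample P X p) {y : ℕ} (hp : ∀ x, y < x → p x = 0)
    (n : ℕ) :
    P.real {ω | Antitone (empirical (sample X n ω))} =
      P.real {ω | DecreasingUpTo y (empirical (sample X n ω))} := by
  refine measureReal_congr ?_
  filter_upwards [hX.ae_le hp] with ω hω
  exact propext (antitone_empirical_iff fun i => hω i)

/-! ### Law of large numbers -/

theorem integrable_comp (hX : IsIIDSample P X p) (i : ℕ) {φ : ℕ → ℝ} {C : ℝ}
    (hφ : ∀ m, |φ m| ≤ C) : Integrable (fun ω => φ (X i ω)) P :=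
  Integrable.of_bound
    ((measurable_of_countable φ).comp (hX.measurable i)).aestronglyMeasurable C
    (Eventually.of_forall fun _ => hφ _)

theorem abs_pointIndicator_le (x m : ℕ) : |pointIndicator x m| ≤ 1 := by
  unfold pointIndicator; split_ifs <;> simp

theorem ae_tendsto_empirical (hX : IsIIDSample P X p) :
    ∀ᵐ ω ∂P, ∀ x, Tendsto (fun n => empirical (sample X n ω) x) atTop (𝓝 (p x)) := by
  refine ae_all_iff.2 fun x => ?_
  have hmeas : Measurable (pointIndicator x) := measurable_of_countable _
  have := strong_law_ae_real (fun i ω => pointIndicator x (X i ω))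
    (hX.integrable_comp 0 (abs_pointIndicator_le x))
    (fun i j hij => (hX.indep.indepFun hij).comp hmeas hmeas)
    (fun i => (hX.identDistrib i 0).comp hmeas)
  rw [hX.integral_pointIndicator 0 x] at this
  simpa only [empirical_sample] using this

theorem tendsto_decreasingUpTo_of_strictAntiOn (hX : IsIIDSample P X p) {y : ℕ}
    (hp : StrictAntiOn p (Set.Iic y)) :
    Tendsto (fun n : ℕ => P.real {ω | DecreasingUpTo y (empirical (sample X n ω))})
      atTop (𝓝 1) := by
  have h := tendsto_measure_of_ae_tendsto_indicator_of_isFiniteMeasure (μ := P) atTop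
    (A := Set.univ) (As := fun n => {ω | DecreasingUpTo y (empirical (sample X n ω))})
    MeasurableSet.univ (fun n => hX.measurableSet_sample n fun s => DecreasingUpTo y (empirical s))
    (by
      filter_upwards [hX.ae_tendsto_empirical] with ω hω
      simp only [Set.mem_univ, iff_true, DecreasingUpTo]
      refine (eventually_all_finite (Set.finite_Iio y)).2 fun x hx => ?_
      have hlt : p (x + 1) < p x :=
        hp (Set.mem_Iic.2 (Set.mem_Iio.1 hx).le) (Set.mem_Iic.2 hx) (Nat.lt_succ_self x)
      exact ((hω (x + 1)).eventually_lt (hω x) hlt).mono fun n hn => hn.le)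
  rw [measure_univ] at h
  exact (ENNReal.tendsto_toReal ENNReal.one_ne_top).comp h

/-! ### Ties have vanishing probability -/

/-- The portmanteau bound for the closed set `{0}` in the central limit theorem; nonzero variance
makes the limiting Gaussian atomless. -/
theorem tendsto_measureReal_sum_eq_zero {Z : ℕ → Ω → ℝ} (hZ : MemLp (Z 0) 2 P)
    (hindep : iIndepFun Z P) (hident : ∀ i, IdentDistrib (Z i) (Z 0) P P)
    (hmean : ∫ ω, Z 0 ω ∂P = 0) (hvar : Var[Z 0; P] ≠ 0) :
    Tendsto (fun n : ℕ => P.real {ω | ∑ i ∈ Finset.range n, Z i ω = 0}) atTop (𝓝 0) := by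
  have hclt := tendstoInDistribution_inv_sqrt_mul_sum_sub (P := P) (X := Z)
    (P' := gaussianReal 0 Var[Z 0; P].toNNReal) (Y := id) HasLaw.id hZ hindep hident
  have hv : Var[Z 0; P].toNNReal ≠ 0 := by
    rw [Ne, Real.toNNReal_eq_zero, not_le]
    exact lt_of_le_of_ne (variance_nonneg _ _) hvar.symm
  have := nullSingletonClass_gaussianReal (μ := 0) hv
  have hport := ProbabilityMeasure.limsup_measure_closed_le_of_tendsto hclt.tendsto
    (isClosed_singleton (x := (0 : ℝ)))
  simp only [ProbabilityMeasure.coe_mk, Measure.map_id, measure_singleton, hmean, mul_zero,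
    sub_zero] at hport
  have hlim : Tendsto (fun n : ℕ => P.map (fun ω => (√(n : ℝ))⁻¹ *
      ∑ k ∈ Finset.range n, Z k ω) {0}) atTop (𝓝 0) :=
    tendsto_of_le_liminf_of_limsup_le zero_le hport
  have hreal := (ENNReal.tendsto_toReal ENNReal.zero_ne_top).comp hlim
  refine tendsto_of_tendsto_of_tendsto_of_le_of_le tendsto_const_nhds hreal
    (fun n => measureReal_nonneg) fun n => ?_
  have hae : AEMeasurable (fun ω => (√(n : ℝ))⁻¹ * ∑ k ∈ Finset.range n, Z k ω) P :=
    (Finset.aemeasurable_fun_sum _ fun i _ => (hident i).aemeasurable_fst).const_mul _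
  simp only [Function.comp_apply]
  rw [Measure.map_apply_of_aemeasurable hae (measurableSet_singleton _)]
  refine measureReal_mono fun ω (hω : _ = _) => ?_
  simp [hω]

theorem tendsto_measureReal_empirical_eq (hX : IsIIDSample P X p) {a b : ℕ} (hab : a ≠ b)
    (hp : p a = p b) (hpos : 0 < p a) :
    Tendsto (fun n : ℕ => P.real {ω | empirical (sample X n ω) a = empirical (sample X n ω) b})
      atTop (𝓝 0) := by
  set φ : ℕ → ℝ := fun m => pointIndicator a m - pointIndicator b m with hφ
  have hmeas : Measurable φ := measurable_of_countable _
  have hbound : ∀ m, |φ m| ≤ 2 := fun m => (abs_sub _ _).trans (by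
    linarith [abs_pointIndicator_le a m, abs_pointIndicator_le b m])
  have hmean : ∫ ω, φ (X 0 ω) ∂P = 0 := by
    rw [integral_sub (hX.integrable_comp 0 (abs_pointIndicator_le a))
      (hX.integrable_comp 0 (abs_pointIndicator_le b)), hX.integral_pointIndicator,
      hX.integral_pointIndicator, hp, sub_self]
  have hφm : Measurable fun ω => φ (X 0 ω) := hmeas.comp (hX.measurable 0)
  have hmem : MemLp (fun ω => φ (X 0 ω)) 2 P :=
    MemLp.of_bound hφm.aestronglyMeasurable 2 (Eventually.of_forall fun ω => hbound _)
  have hvar : Var[fun ω => φ (X 0 ω); P] ≠ 0 := by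
    intro h0
    rw [variance_of_integral_eq_zero hφm.aemeasurable hmean,
      integral_eq_zero_iff_of_nonneg (fun ω => sq_nonneg _) hmem.integrable_sq] at h0
    -- Zero variance forces `φ (X 0) = 0` almost surely, while `φ a = 1`.
    have hnull : P.real {ω | X 0 ω = a} = 0 := by
      rw [measureReal_eq_zero_iff]
      refine measure_mono_null (fun ω (hω : X 0 ω = a) => ?_) (ae_iff.1 h0)
      simp [hφ, pointIndicator, hω, hab]
    rw [hX.law] at hnull
    exact hpos.ne' hnull
  refine (tendsto_measureReal_sum_eq_zero (Z := fun i ω => φ (X i ω)) hmem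
    (hX.indep.comp (fun _ => φ) fun _ => hmeas) (fun i => (hX.identDistrib i 0).comp hmeas)
    hmean hvar).congr' ?_
  filter_upwards [eventually_ne_atTop 0] with n hn
  have hn' : (n : ℝ) ≠ 0 := Nat.cast_ne_zero.2 hn
  congr 1
  ext ω
  simp only [Set.mem_ofPred_eq, empirical_sample, hφ, Finset.sum_sub_distrib, sub_eq_zero,
    div_left_inj' hn']

/-! ### Exchangeability -/

theorem map_sample (hX : IsIIDSample P X p) (n : ℕ) {τ : ℕ → ℕ}
    (hτ : ∀ x, P.real {ω | τ (X 0 ω) = x} = p x) :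
    P.map (fun ω i => τ (sample X n ω i)) = P.map (sample X n) := by
  have hτm : Measurable τ := measurable_of_countable _
  have h1 : iIndepFun (fun (i : Fin n) => X i) P := hX.indep.precomp Fin.val_injective
  have h2 : iIndepFun (fun (i : Fin n) => τ ∘ X i) P := h1.comp _ fun _ => hτm
  have e1 := (iIndepFun_iff_map_fun_eq_pi_map
    fun i : Fin n => (hX.measurable i).aemeasurable).1 h1
  have e2 := (iIndepFun_iff_map_fun_eq_pi_map
    fun i : Fin n => (hτm.comp (hX.measurable i)).aemeasurable).1 h2
  refine e2.trans (Eq.trans ?_ e1.symm)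
  congr 1
  funext i
  rw [((hX.identDistrib i 0).comp hτm).map_eq, (hX.identDistrib i 0).map_eq]
  exact map_eq_map_of_law (hτm.comp (hX.measurable 0)) (hX.measurable 0) fun x =>
    (hτ x).trans (hX.law 0 x).symm

/-- Relabelling the values by a permutation that preserves `p` leaves the law of the sample
unchanged. -/
theorem measureReal_perm (hX : IsIIDSample P X p) (n : ℕ) {τ : Equiv.Perm ℕ}
    (hτ : ∀ x, p (τ x) = p x) (Q : (Fin n → ℕ) → Prop) :
    P.real {ω | Q fun i => τ.symm (sample X n ω i)} = P.real {ω | Q (sample X n ω)} := by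
  have h := hX.map_sample n (τ := τ.symm) fun x => by
    simp only [Equiv.symm_apply_eq]
    rw [hX.law, hτ]
  have hQ : MeasurableSet {s : Fin n → ℕ | Q s} := MeasurableSet.of_discrete
  have hm : Measurable fun ω i => τ.symm (sample X n ω i) :=
    (measurable_of_countable (fun (s : Fin n → ℕ) i => τ.symm (s i))).comp (hX.measurable_sample n)
  have h1 := congrArg (fun ν => ν.real {s | Q s}) h
  simp only [measureReal_def, Measure.map_apply hm hQ,
    Measure.map_apply (hX.measurable_sample n) hQ] at h1
  exact h1

theorem measureReal_strictAnti_perm (hX : IsIIDSample P X p) {y : ℕ} (n : ℕ)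
    (hp : ∀ a b, a ≤ y → b ≤ y → p a = p b) (σ : Equiv.Perm (Fin (y + 1))) :
    P.real {ω | StrictAnti fun a : Fin (y + 1) => empirical (sample X n ω) (σ a)} =
      P.real {ω | StrictAnti fun a : Fin (y + 1) => empirical (sample X n ω) a} := by
  -- `σ` extended to `ℕ` by the identity beyond `y`, where `p` need not be constant.
  set τ : Equiv.Perm ℕ := σ.viaFintypeEmbedding Fin.valEmbedding with hτ
  have hval : ∀ a : Fin (y + 1), τ a = σ a := fun a =>
    Equiv.Perm.viaFintypeEmbedding_apply_image σ Fin.valEmbedding a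
  have hpτ : ∀ x, p (τ x) = p x := by
    intro x
    rcases Nat.lt_or_ge x (y + 1) with hx | hx
    · rw [hval ⟨x, hx⟩]
      exact hp _ _ (Nat.lt_succ_iff.1 (σ _).isLt) (Nat.lt_succ_iff.1 hx)
    · rw [hτ, Equiv.Perm.viaFintypeEmbedding_apply_notMem_range]
      rintro ⟨a, rfl⟩
      exact absurd a.isLt (not_lt.2 hx)
  rw [← hX.measureReal_perm n hpτ fun s => StrictAnti fun a : Fin (y + 1) => empirical s a]
  simp only [empirical_comp_perm, hval]

/-- An injective vector is put in strictly decreasing order by exactly one permutation, so the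
equiprobable ordering events partition the event without ties. -/
theorem factorial_mul_measureReal_strictAnti (hX : IsIIDSample P X p) {y : ℕ} (n : ℕ)
    (hp : ∀ a b, a ≤ y → b ≤ y → p a = p b) :
    ((y + 1).factorial : ℝ) *
        P.real {ω | StrictAnti fun a : Fin (y + 1) => empirical (sample X n ω) a} =
      P.real {ω | Function.Injective fun a : Fin (y + 1) => empirical (sample X n ω) a} := by
  have hU : {ω | Function.Injective fun a : Fin (y + 1) => empirical (sample X n ω) a} =
      ⋃ σ : Equiv.Perm (Fin (y + 1)),
        {ω | StrictAnti fun a : Fin (y + 1) => empirical (sample X n ω) (σ a)} := by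
    ext ω
    simp only [Set.mem_ofPred_eq, Set.mem_iUnion]
    refine ⟨fun h => ?_, ?_⟩
    · set f := fun a : Fin (y + 1) => empirical (sample X n ω) a
      have hanti : Antitone (f ∘ Tuple.sort (OrderDual.toDual ∘ f)) := antitone_rear f
      exact ⟨_, hanti.strictAnti_of_injective (h.comp (Equiv.injective _))⟩
    · rintro ⟨σ, hσ⟩
      exact (Equiv.injective_comp σ _).1 hσ.injective
  rw [hU, measureReal_iUnion_fintype]
  · simp only [hX.measureReal_strictAnti_perm n hp, Finset.sum_const, Finset.card_univ,
      Fintype.card_perm, Fintype.card_fin, nsmul_eq_mul]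
  · intro σ σ' hne
    refine Set.disjoint_left.2 fun ω h h' => hne ?_
    have hf : Function.Injective fun a : Fin (y + 1) => empirical (sample X n ω) a :=
      (Equiv.injective_comp σ _).1 h.injective
    have heq := Tuple.unique_antitone (f := fun a : Fin (y + 1) => empirical (sample X n ω) a)
      (σ := σ) (τ := σ') h.antitone h'.antitone
    exact Equiv.ext fun a => hf (congrFun heq a)
  · exact fun σ => hX.measurableSet_sample n
      fun s => StrictAnti fun a : Fin (y + 1) => empirical s (σ a)

theorem tendsto_measureReal_injective (hX : IsIIDSample P X p) {y : ℕ}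
    (hp : ∀ a b, a ≤ y → b ≤ y → p a = p b) (hpos : ∀ a, a ≤ y → 0 < p a) :
    Tendsto (fun n : ℕ =>
      P.real {ω | Function.Injective fun a : Fin (y + 1) => empirical (sample X n ω) a})
      atTop (𝓝 1) := by
  -- Union bound over the ordered pairs of distinct cells.
  have hties : Tendsto (fun n : ℕ => 1 - ∑ c ∈ (Finset.univ : Finset (Fin (y + 1))).offDiag,
      P.real {ω | empirical (sample X n ω) c.1 = empirical (sample X n ω) c.2}) atTop (𝓝 1) := by
    have := tendsto_finsetSum (Finset.univ : Finset (Fin (y + 1))).offDiag fun c hc =>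
      hX.tendsto_measureReal_empirical_eq
        (Fin.val_injective.ne (Finset.mem_offDiag.1 hc).2.2)
        (hp _ _ (Nat.lt_succ_iff.1 c.1.isLt) (Nat.lt_succ_iff.1 c.2.isLt))
        (hpos _ (Nat.lt_succ_iff.1 c.1.isLt))
    simpa using this.const_sub 1
  refine tendsto_of_tendsto_of_tendsto_of_le_of_le hties tendsto_const_nhds (fun n => ?_)
    fun n => measureReal_le_one
  have hm := hX.measurableSet_sample n
    fun s => Function.Injective fun a : Fin (y + 1) => empirical s a
  rw [sub_le_comm, ← probReal_compl_eq_one_sub hm]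
  refine le_trans (measureReal_mono (fun ω hω => ?_) (measure_ne_top _ _))
    (measureReal_biUnion_finset_le _ _)
  simp only [Set.mem_compl_iff, Set.mem_ofPred_eq, Function.Injective, not_forall] at hω
  obtain ⟨a, b, hab, hne⟩ := hω
  exact Set.mem_biUnion (x := (a, b)) (by simpa using hne) hab

/-- Squeeze: strict decrease implies decrease, and decrease without ties is strict, so the two
probabilities differ by at most that of a tie. -/
theorem tendsto_decreasingUpTo_of_uniform (hX : IsIIDSample P X p) {y : ℕ}
    (hp : ∀ a b, a ≤ y → b ≤ y → p a = p b) (hpos : ∀ a, a ≤ y → 0 < p a) :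
    Tendsto (fun n : ℕ => P.real {ω | DecreasingUpTo y (empirical (sample X n ω))})
      atTop (𝓝 (1 / ((y + 1).factorial : ℝ))) := by
  have hinj := hX.tendsto_measureReal_injective hp hpos
  have hfac : ((y + 1).factorial : ℝ) ≠ 0 := Nat.cast_ne_zero.2 (Nat.factorial_ne_zero _)
  have hstrict : Tendsto (fun n : ℕ =>
      P.real {ω | StrictAnti fun a : Fin (y + 1) => empirical (sample X n ω) a}) atTop
      (𝓝 (1 / ((y + 1).factorial : ℝ))) := by
    refine (hinj.div_const _).congr fun n => ?_
    rw [← hX.factorial_mul_measureReal_strictAnti n hp, mul_div_cancel_left₀ _ hfac]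
  have hupper := hstrict.add (hinj.const_sub 1)
  rw [sub_self, add_zero] at hupper
  refine tendsto_of_tendsto_of_tendsto_of_le_of_le hstrict hupper (fun n => ?_) fun n => ?_
  · refine measureReal_mono fun ω (h : StrictAnti _) x hx => ?_
    exact (@h ⟨x, by omega⟩ ⟨x + 1, by omega⟩ (Fin.mk_lt_mk.2 (Nat.lt_succ_self x))).le
  · have hm := hX.measurableSet_sample n
      fun s => Function.Injective fun a : Fin (y + 1) => empirical s a
    simp only
    rw [← probReal_compl_eq_one_sub hm]
    refine le_trans (measureReal_mono fun ω (h : DecreasingUpTo y _) => ?_)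
      (measureReal_union_le _ _)
    by_cases hi : Function.Injective fun a : Fin (y + 1) => empirical (sample X n ω) a
    · refine Or.inl (Antitone.strictAnti_of_injective ?_ hi)
      exact Fin.antitone_iff_succ_le.2 fun i => h i i.isLt
    · exact Or.inr hi

end IsIIDSample

end

end MonotonePMF

end

theorem mainTheorem1 {Ω : Type*} [MeasurableSpace Ω] (P : Measure Ω) [IsProbabilityMeasure P]
    (X : ℕ → Ω → ℕ) (p : ℕ → ℝ) (hp : MonotonePMF.IsMassFunction p)
    (hX : MonotonePMF.IsIIDSample P X p) :
    -- (i)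
    (Antitone p → ∀ n : ℕ, 1 ≤ n → ∀ ω : Ω,
      max (MonotonePMF.hellinger (MonotonePMF.grenander (MonotonePMF.sample X n ω)) p)
          (MonotonePMF.hellinger (MonotonePMF.rearrangement (MonotonePMF.sample X n ω)) p)
        ≤ MonotonePMF.hellinger (MonotonePMF.empirical (MonotonePMF.sample X n ω)) p ∧
      ∀ k : ℝ≥0∞, 1 ≤ k →
        max (MonotonePMF.ellDist k (MonotonePMF.grenander (MonotonePMF.sample X n ω)) p)
            (MonotonePMF.ellDist k (MonotonePMF.rearrangement (MonotonePMF.sample X n ω)) p)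
          ≤ MonotonePMF.ellDist k (MonotonePMF.empirical (MonotonePMF.sample X n ω)) p) ∧
    -- (ii)
    (∀ y : ℕ, p = MonotonePMF.uniformMass y → ∀ᵐ ω ∂P, ∀ n : ℕ, 1 ≤ n →
      MonotonePMF.hellinger (MonotonePMF.empirical (MonotonePMF.sample X n ω)) p
        = MonotonePMF.hellinger (MonotonePMF.rearrangement (MonotonePMF.sample X n ω)) p ∧
      ∀ k : ℝ≥0∞, 1 ≤ k →
        MonotonePMF.ellDist k (MonotonePMF.rearrangement (MonotonePMF.sample X n ω)) p
          = MonotonePMF.ellDist k (MonotonePMF.empirical (MonotonePMF.sample X n ω)) p) ∧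
    -- (iii), coincidence of the three estimators
    (∀ n : ℕ, 1 ≤ n → ∀ ω : Ω,
      Antitone (MonotonePMF.empirical (MonotonePMF.sample X n ω)) →
        MonotonePMF.grenander (MonotonePMF.sample X n ω)
          = MonotonePMF.rearrangement (MonotonePMF.sample X n ω) ∧
        MonotonePMF.rearrangement (MonotonePMF.sample X n ω)
          = MonotonePMF.empirical (MonotonePMF.sample X n ω)) ∧
    -- (iii), uniform distribution
    (∀ y : ℕ, p = MonotonePMF.uniformMass y →
      (∀ n : ℕ, 1 ≤ n →
        P.real {ω | Antitone (MonotonePMF.empirical (MonotonePMF.sample X n ω))}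
          = P.real {ω | MonotonePMF.DecreasingUpTo y
              (MonotonePMF.empirical (MonotonePMF.sample X n ω))}) ∧
      Tendsto (fun n : ℕ => P.real {ω | MonotonePMF.DecreasingUpTo y
          (MonotonePMF.empirical (MonotonePMF.sample X n ω))})
        atTop (𝓝 (1 / ((y + 1).factorial : ℝ)))) ∧
    -- (iii), strictly decreasing mass function with support `{0, …, y}`
    (∀ y : ℕ, StrictAntiOn p (Set.Iic y) → Function.support p = Set.Iic y →
      (∀ n : ℕ, 1 ≤ n →
        P.real {ω | Antitone (MonotonePMF.empirical (MonotonePMF.sample X n ω))}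
          = P.real {ω | MonotonePMF.DecreasingUpTo y
              (MonotonePMF.empirical (MonotonePMF.sample X n ω))}) ∧
      Tendsto (fun n : ℕ => P.real {ω | MonotonePMF.DecreasingUpTo y
          (MonotonePMF.empirical (MonotonePMF.sample X n ω))})
        atTop (𝓝 1)) := by
  have hunif : ∀ y, p = MonotonePMF.uniformMass y → ∀ x, y < x → p x = 0 := by
    rintro y rfl x hx
    exact MonotonePMF.uniformMass_of_lt hx
  refine ⟨fun hanti n _ ω => ⟨?_, fun k hk => ?_⟩, fun y hy => ?_, fun n _ ω h => ?_,
    fun y hy => ⟨fun n _ => hX.measureReal_antitone_eq (hunif y hy) n, ?_⟩,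
    fun y hstrict hsupp => ⟨fun n _ => hX.measureReal_antitone_eq (fun x hx => ?_) n,
      hX.tendsto_decreasingUpTo_of_strictAntiOn hstrict⟩⟩
  · exact max_le (MonotonePMF.hellinger_grenander_le _ hanti hp.1)
      (MonotonePMF.hellinger_rearrangement_le _ hanti)
  · exact max_le (MonotonePMF.ellDist_grenander_le _ hanti hk)
      (MonotonePMF.ellDist_rearrangement_le _ hanti hk)
  · filter_upwards [hX.ae_le (hunif y hy)] with ω hω n _
    have hconst : ∀ x, x ≤ MonotonePMF.sampleMax (MonotonePMF.sample X n ω) →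
        p x = 1 / ((y : ℝ) + 1) := by
      intro x hx
      rw [hy]
      exact MonotonePMF.uniformMass_of_le (hx.trans (Finset.sup_le fun i _ => hω i))
    exact ⟨(MonotonePMF.hellinger_rearrangement_eq hconst).symm,
      fun k hk => MonotonePMF.ellDist_rearrangement_eq hconst hk⟩
  · rw [MonotonePMF.grenander_eq_empirical h, MonotonePMF.rearrangement_eq_empirical h]
    exact ⟨rfl, rfl⟩
  · refine hX.tendsto_decreasingUpTo_of_uniform (fun a b ha hb => ?_) fun a ha => ?_
    · rw [hy, MonotonePMF.uniformMass_of_le ha, MonotonePMF.uniformMass_of_le hb]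
    · rw [hy, MonotonePMF.uniformMass_of_le ha]
      positivity
  · by_contra hne
    have hmem : x ∈ Function.support p := hne
    rw [hsupp] at hmem
    exact absurd (Set.mem_Iic.1 hmem) hx.not_ge
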